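/- Let $\Bbbk$ be a field, let $G$ be a finite simple graph, and let $\pi=\{W_1,\dots,W_r\}$ be a clique partition of $G$, that is, $V(G)$ is the disjoint union of $W_1,\dots,W_r$ and each $W_i$ is a clique of $G$. Let $G^\pi$ be the clique-whiskered graph: its vertex set is $V(G)\cup\{w_1,\dots,w_r\}$ with new vertices $w_1,\dots,w_r$, and its edges are those of $G$ together with $\{x,w_i\}$ for all $i$ and all $x\in W_i$. Let $S$ be the polynomial ring over $\Bbbk$ whose variables are the vertices of $G^\pi$, with maximal ideal $\mathfrak m$ generated by the variables. For a finite set $C$ of vertices put $\mathbf z_C=\prod_{u\in C}u\in S$, and let $J(G^\pi)=(\mathbf z_C : C \text{ is a vertex cover of } G^\pi)$ be the cover ideal. Fix a total order on $V(G)$ in which all elements of $W_i$ precede all elements of $W_j$ whenever $i<j$. For $i\ge 0$ let $F_i$ be the free $S$-module with basis the symbols $\mathbf f(C;\sigma)$, where $C$ is a minimal vertex cover of $G^\pi$ and $\sigma\subseteq V(G)\setminus C$ with $|\sigma|=i$; the symbol $\mathbf f(C;\sigma)$ has multidegree $\mathbf z_C\prod_{x\in\sigma}x$. Define $d_0:F_0\to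 J(G^\pi)$ by $d_0(\mathbf f(C;\emptyset))=\mathbf z_C$, and for $i>0$ define $d_i:F_i\to F_{i-1}$ by $$d_i(\mathbf f(C;\sigma))=\sum_{x\in\sigma}(-1)^{\alpha(\sigma;x)}\bigl[w_{j(x)}\,\mathbf f((C\setminus\{w_{j(x)}\})\cup\{x\};\sigma\setminus\{x\})-x\,\mathbf f(C;\sigma\setminus\{x\})\bigr],$$ where $j(x)$ is the index with $x\in W_{j(x)}$ and $\alpha(\sigma;x)=|\{y\in\sigma : y>x\}|$. (Here $(C\setminus\{w_{j(x)}\})\cup\{x\}$ is again a minimal vertex cover of $G^\pi$.) Then $$\cdots\longrightarrow F_i\xrightarrow{\;d_i\;}F_{i-1}\longrightarrow\cdots\xrightarrow{\;d_1\;}F_0\xrightarrow{\;d_0\;}J(G^\pi)\longrightarrow 0$$ is a minimal multigraded free resolution of $J(G^\pi)$: the $F_i$ are free of finite rank, all $d_i$ preserve multidegrees, the sequence is exact, and $d_i(F_i)\subseteq\mathfrak m F_{i-1}$ for all $i\ge1$. -/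

import Mathlib

open MvPolynomial

/-! ### Vertex covers, cover ideals, clique-whiskered graphs -/

/-- `C` is a minimal vertex cover of `H`: a vertex cover that is minimal with respect to
inclusion. -/
def IsMinVertexCover {U : Type*} (H : SimpleGraph U) (C : Finset U) : Prop :=
  Minimal (fun D : Finset U => H.IsVertexCover (D : Set U)) C

/-- The squarefree monomial `z_C = ∏_{u ∈ C} u`. -/
noncomputable def coverMonomial (k : Type*) [Field k] {U : Type*} (C : Finset U) :
    MvPolynomial U k :=
  ∏ u ∈ C, X u

/-- The cover ideal of `H`, in the polynomial ring whose variables are the vertices of `H`: the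
ideal generated by the monomials `z_C`, where `C` is a vertex cover of `H`. -/
noncomputable def coverIdeal (k : Type*) [Field k] {U : Type*} (H : SimpleGraph U) :
    Ideal (MvPolynomial U k) :=
  Ideal.span {p | ∃ C : Finset U, H.IsVertexCover (C : Set U) ∧ p = coverMonomial k C}

/-- A clique partition `π = {W_1, …, W_r}` of `G`: `part v` is the index of the part that
contains the vertex `v`, so `W_i = {v | part v = i}`, and every `W_i` is a clique of `G`. -/
structure CliquePartition {V : Type*} (G : SimpleGraph V) (r : ℕ) where
  part : V → Fin r
  isClique : ∀ i : Fin r, G.IsClique {v | part v = i}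

/-- The clique-whiskered graph `G^π`: to the graph `G` (on the vertices `Sum.inl v`) new vertices
`w_i = Sum.inr i` are added, and `w_i` is joined exactly to the vertices of `W_i`. -/
def cliqueWhiskered {V : Type*} {G : SimpleGraph V} {r : ℕ} (π : CliquePartition G r) :
    SimpleGraph (V ⊕ Fin r) where
  Adj
    | Sum.inl u, Sum.inl v => G.Adj u v
    | Sum.inl u, Sum.inr i => π.part u = i
    | Sum.inr i, Sum.inl u => π.part u = i
    | Sum.inr _, Sum.inr _ => False
  symm := ⟨by
    rintro (u | i) (v | j) h
    · exact SimpleGraph.Adj.symm (G := G) h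
    · exact h
    · exact h
    · exact h⟩
  loopless := ⟨by
    rintro (u | i) h
    · exact G.loopless.irrefl u h
    · exact h⟩

/-! ### The replacement `C ↦ (C ∖ {w_i}) ∪ {x}` preserves minimal vertex covers -/

theorem cliqueWhiskered_isVertexCover_iff {V : Type*} {G : SimpleGraph V} {r : ℕ}
    (π : CliquePartition G r) (C : Finset (V ⊕ Fin r)) :
    (cliqueWhiskered π).IsVertexCover (C : Set (V ⊕ Fin r)) ↔
      (∀ u v, G.Adj u v → Sum.inl u ∈ C ∨ Sum.inl v ∈ C) ∧
        ∀ v, Sum.inl v ∈ C ∨ Sum.inr (π.part v) ∈ C := by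
  constructor
  · intro h
    refine ⟨fun u v huv => ?_, fun v => ?_⟩
    · exact h (v := Sum.inl u) (w := Sum.inl v) huv
    · exact h (v := Sum.inl v) (w := Sum.inr (π.part v)) rfl
  · rintro ⟨h1, h2⟩ (u | i) (v | j) h
    · exact h1 u v h
    · have h : π.part u = j := h
      subst h
      exact h2 u
    · have h : π.part v = i := h
      subst h
      exact (h2 v).symm
    · exact h.elim

theorem IsMinVertexCover.exists_inl_notMem {V : Type*} [DecidableEq V] {G : SimpleGraph V} {r : ℕ}
    {π : CliquePartition G r} {C : Finset (V ⊕ Fin r)}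
    (hC : IsMinVertexCover (cliqueWhiskered π) C) {j : Fin r} (hj : Sum.inr j ∈ C) :
    ∃ z, π.part z = j ∧ Sum.inl z ∉ C := by
  by_contra! hcon
  obtain ⟨h1, h2⟩ := (cliqueWhiskered_isVertexCover_iff π C).1 hC.prop
  have hcov : (cliqueWhiskered π).IsVertexCover
      ((C.erase (Sum.inr j) : Finset (V ⊕ Fin r)) : Set (V ⊕ Fin r)) := by
    rw [cliqueWhiskered_isVertexCover_iff]
    refine ⟨fun u v huv => by simpa using h1 u v huv, fun v => ?_⟩
    by_cases hv : π.part v = j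
    · left; simpa using hcon v hv
    · simpa [hv] using h2 v
  have h3 := hC.le_of_le hcov (Finset.erase_subset _ _) hj
  simp at h3

theorem IsMinVertexCover.swap {V : Type*} [DecidableEq V] {G : SimpleGraph V} {r : ℕ}
    {π : CliquePartition G r} {C : Finset (V ⊕ Fin r)}
    (hC : IsMinVertexCover (cliqueWhiskered π) C) {x : V} (hx : Sum.inl x ∉ C) :
    IsMinVertexCover (cliqueWhiskered π)
      (insert (Sum.inl x) (C.erase (Sum.inr (π.part x)))) := by
  obtain ⟨h1, h2⟩ := (cliqueWhiskered_isVertexCover_iff π C).1 hC.prop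
  have hblock : ∀ y z, π.part y = π.part z → y ≠ z → Sum.inl z ∉ C → Sum.inl y ∈ C :=
    fun y z hyz hne hz => (h1 y z (π.isClique (π.part z) hyz rfl hne)).resolve_right hz
  refine ⟨?_, fun D hD hle => ?_⟩
  · show (cliqueWhiskered π).IsVertexCover _
    rw [cliqueWhiskered_isVertexCover_iff]
    refine ⟨fun u v huv => ?_, fun v => ?_⟩
    · rcases h1 u v huv with h | h <;> simp [h]
    · by_cases hv : π.part v = π.part x
      · left
        by_cases hvx : v = x
        · simp [hvx]
        · simp [hblock v x hv hvx hx]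
      · rcases h2 v with h | h <;> simp [h, hv]
  · obtain ⟨g1, g2⟩ := (cliqueWhiskered_isVertexCover_iff π D).1 hD
    rintro (y | j) hu
    · by_cases hw : Sum.inr (π.part y) ∈ D
      · have hw' := hle hw
        simp only [Finset.mem_insert, reduceCtorEq, Finset.mem_erase, ne_eq, Sum.inr.injEq,
          false_or] at hw'
        obtain ⟨hne, hwC⟩ := hw'
        obtain ⟨z, hz, hzC⟩ := hC.exists_inl_notMem hwC
        have hzx : z ≠ x := fun h => hne (by rw [← hz, h])
        have hzD : Sum.inl z ∉ D := fun h => by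
          have := hle h
          simp [hzx, hzC] at this
        have hyz : y ≠ z := by
          rintro rfl
          simp [hzx, hzC] at hu
        exact (g1 y z (π.isClique (π.part y) rfl hz hyz)).resolve_right hzD
      · exact (g2 y).resolve_right hw
    · simp only [Finset.mem_insert, reduceCtorEq, Finset.mem_erase, ne_eq, Sum.inr.injEq,
        false_or] at hu
      obtain ⟨hne, hwC⟩ := hu
      obtain ⟨z, hz, hzC⟩ := hC.exists_inl_notMem hwC
      have hzx : z ≠ x := fun h => hne (by rw [← hz, h])
      have hzD : Sum.inl z ∉ D := fun h => by
        have := hle h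
        simp [hzx, hzC] at this
      subst hz
      exact (g2 z).resolve_left hzD

/-! ### Minimal multigraded free resolutions over a polynomial ring -/

/-- Let `B` index a basis of the free module `B →₀ R` over a polynomial ring `R` with variables
`U`, the basis element `b` having multidegree `deg b` (an exponent vector). The element `f` is
homogeneous of multidegree `a`: every monomial `m` of the coefficient of `b` in `f` satisfies
`m + deg b = a`. -/
def IsMultihomogeneous {k U B : Type*} [Field k] (deg : B → (U →₀ ℕ)) (a : U →₀ ℕ)
    (f : B →₀ MvPolynomial U k) : Prop :=
  ∀ b, ∀ m ∈ (f b).support, m + deg b = a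

/-- Let `R` be the polynomial ring over the field `k` with variables `U`, let `J` be an ideal of
`R`, and let `B i` index a basis of the free module `F i = (B i →₀ R)`, with multidegrees
`deg i`. The sequence
`⋯ ⟶ F 2 --(d 1)--> F 1 --(d 0)--> F 0 --ε--> J ⟶ 0` is a minimal multigraded free resolution
of `J`: the free modules have finite rank, all maps preserve multidegrees, the sequence is exact
(in particular it is a complex), and it is minimal, that is, the image of `F (i + 1)` in `F i`
lies in `𝔪 (F i)`, where `𝔪` is the ideal generated by the variables. -/
structure IsMinimalFreeResolution {k U : Type*} [Field k] (J : Ideal (MvPolynomial U k))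
    (B : ℕ → Type*) (deg : ∀ i, B i → (U →₀ ℕ))
    (d : ∀ i, (B (i + 1) →₀ MvPolynomial U k) →ₗ[MvPolynomial U k] (B i →₀ MvPolynomial U k))
    (ε : (B 0 →₀ MvPolynomial U k) →ₗ[MvPolynomial U k] J) : Prop where
  finite : ∀ i, Finite (B i)
  homogeneous_d : ∀ i a f, IsMultihomogeneous (deg (i + 1)) a f →
    IsMultihomogeneous (deg i) a (d i f)
  homogeneous_ε : ∀ a f, IsMultihomogeneous (deg 0) a f →
    ∀ m ∈ (ε f : MvPolynomial U k).support, m = a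
  exact_d : ∀ i, Function.Exact (d (i + 1)) (d i)
  exact_ε : Function.Exact (d 0) ε
  surjective_ε : Function.Surjective ε
  minimal : ∀ i, LinearMap.range (d i) ≤
    (Ideal.span (Set.range X) : Ideal (MvPolynomial U k)) •
      (⊤ : Submodule (MvPolynomial U k) (B i →₀ MvPolynomial U k))

/-! ### The explicit complex -/

/-- The symbols `f(C; σ)` in homological degree `i`: `C` is a minimal vertex cover of `G^π` and
`σ` is a subset of `V(G) ∖ C` of size `i`. -/
@[ext]
structure BasisSymbol {V : Type*} {G : SimpleGraph V} {r : ℕ} (π : CliquePartition G r)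
    (i : ℕ) where
  cover : Finset (V ⊕ Fin r)
  face : Finset V
  isMin : IsMinVertexCover (cliqueWhiskered π) cover
  notMem : ∀ v ∈ face, Sum.inl v ∉ cover
  card_face : face.card = i

namespace BasisSymbol

/-- The multidegree of `f(C; σ)`: the exponent vector of `z_C x_σ`. -/
noncomputable def multidegree {V : Type*} {G : SimpleGraph V} {r : ℕ} {π : CliquePartition G r}
    {i : ℕ} (f : BasisSymbol π i) : (V ⊕ Fin r) →₀ ℕ :=
  (∑ u ∈ f.cover, Finsupp.single u 1) + ∑ v ∈ f.face, Finsupp.single (Sum.inl v) 1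

/-- The symbol `f(C; σ ∖ {x})`. -/
def drop {V : Type*} [DecidableEq V] {G : SimpleGraph V} {r : ℕ} {π : CliquePartition G r} {i : ℕ}
    (f : BasisSymbol π (i + 1)) (x : V) (hx : x ∈ f.face) : BasisSymbol π i where
  cover := f.cover
  face := f.face.erase x
  isMin := f.isMin
  notMem v hv := f.notMem v (Finset.mem_of_mem_erase hv)
  card_face := by rw [Finset.card_erase_of_mem hx, f.card_face, Nat.add_sub_cancel]

/-- The symbol `f((C ∖ {w_i}) ∪ {x}; σ ∖ {x})`, where `x ∈ W_i`. -/
def swap {V : Type*} [DecidableEq V] {G : SimpleGraph V} {r : ℕ} {π : CliquePartition G r} {i : ℕ}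
    (f : BasisSymbol π (i + 1)) (x : V) (hx : x ∈ f.face) : BasisSymbol π i where
  cover := insert (Sum.inl x) (f.cover.erase (Sum.inr (π.part x)))
  face := f.face.erase x
  isMin := f.isMin.swap (f.notMem x hx)
  notMem v hv := by
    have h1 := f.notMem v (Finset.mem_of_mem_erase hv)
    have h2 := Finset.ne_of_mem_erase hv
    simp [h1, h2]
  card_face := by rw [Finset.card_erase_of_mem hx, f.card_face, Nat.add_sub_cancel]

end BasisSymbol

/-- `α(σ; x)`, the number of elements of `σ` that are greater than `x`. -/
def signExponent {V : Type*} [LinearOrder V] (σ : Finset V) (x : V) : ℕ :=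
  (σ.filter (fun y => x < y)).card

/-- The differential from homological degree `i + 1` to homological degree `i`:
`f(C; σ) ↦ ∑_{x ∈ σ} (-1)^α(σ; x) [w_j f((C ∖ {w_j}) ∪ {x}; σ ∖ {x}) - x f(C; σ ∖ {x})]`,
where `W_j` is the part that contains `x`. -/
noncomputable def resolutionDifferential (k : Type*) [Field k] {V : Type*} [LinearOrder V]
    {G : SimpleGraph V} {r : ℕ} (π : CliquePartition G r) (i : ℕ) :
    (BasisSymbol π (i + 1) →₀ MvPolynomial (V ⊕ Fin r) k) →ₗ[MvPolynomial (V ⊕ Fin r) k]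
      (BasisSymbol π i →₀ MvPolynomial (V ⊕ Fin r) k) :=
  Finsupp.linearCombination (MvPolynomial (V ⊕ Fin r) k) fun f =>
    ∑ x ∈ f.face.attach, (-1 : MvPolynomial (V ⊕ Fin r) k) ^ signExponent f.face x.1 •
      (Finsupp.single (f.swap x.1 x.2) (X (Sum.inr (π.part x.1))) -
        Finsupp.single (f.drop x.1 x.2) (X (Sum.inl x.1)))

/-- The augmentation `F_0 ⟶ J(G^π)`, `f(C; ∅) ↦ z_C`. -/
noncomputable def resolutionAugmentation (k : Type*) [Field k] {V : Type*}
    {G : SimpleGraph V} {r : ℕ} (π : CliquePartition G r) :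
    (BasisSymbol π 0 →₀ MvPolynomial (V ⊕ Fin r) k) →ₗ[MvPolynomial (V ⊕ Fin r) k]
      coverIdeal k (cliqueWhiskered π) :=
  Finsupp.linearCombination (MvPolynomial (V ⊕ Fin r) k) fun f =>
    ⟨coverMonomial k f.cover, Ideal.subset_span ⟨f.cover, f.isMin.prop, rfl⟩⟩

/-! ### An ambient complex without constraints on the symbols -/

/-! Filter by the level of `(C, σ)`, the number of vertices of `G` outside `C`. In the differential
the terms `x f(C; σ ∖ {x})` keep `C`, while the terms with coefficient `w_j` put `x` into the cover
and lower the level. Modulo lower levels there remains, for each `C`, a Koszul complex on the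
variables of `V(G) ∖ C`.

A Koszul complex has an explicit contraction. In `m f(C; σ)` let `x` be the least vertex outside `C`
that lies in `σ` or divides `m`; move `x` from `m` into `σ`, or return zero if it is already in `σ`.
This `h` is only `k`-linear, and `dh + hd - id` has lower level (`homotopy_identity`), except on the
residual terms `m f(C; ∅)` with no such `x`. Induction on the level makes every cycle a boundary
plus residual terms (`exists_eq_pairDifferential_add`).

In positive degree there are no residual terms. In degree zero the augmentation is injective on
them: the vertices of `G` that divide `m z_C` are exactly those in `C`, and they determine a minimal
cover (`eq_zero_of_resolutionAugmentation_eq_zero`).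

The computations take place in a free module on all pairs `(C, σ)`, where faces need no proofs of
admissibility; the resolution embeds there compatibly with the differentials. -/

/-- The vertex replacement `C ↦ (C ∖ {w_j}) ∪ {x}`, where `x ∈ W_j`. -/
def swapCover {V : Type*} [DecidableEq V] {G : SimpleGraph V} {r : ℕ} (π : CliquePartition G r)
    (C : Finset (V ⊕ Fin r)) (x : V) : Finset (V ⊕ Fin r) :=
  insert (Sum.inl x) (C.erase (Sum.inr (π.part x)))

/-- Swaps insert only vertices of `G` and delete only whiskers, so they do not interfere, even when
`x` and `y` share a part or `C` is not a cover. -/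
theorem swapCover_comm {V : Type*} [DecidableEq V] {G : SimpleGraph V} {r : ℕ}
    (π : CliquePartition G r) (C : Finset (V ⊕ Fin r)) (x y : V) :
    swapCover π (swapCover π C x) y = swapCover π (swapCover π C y) x := by
  ext u
  simp only [swapCover, Finset.mem_insert, Finset.mem_erase]
  rcases u with u | u <;> simp <;> tauto

/-- The free module on all pairs `(C, σ)`. -/
abbrev PairModule (k : Type*) [Field k] (V : Type*) (r : ℕ) : Type _ :=
  (Finset (V ⊕ Fin r) × Finset V) →₀ MvPolynomial (V ⊕ Fin r) k

section Ambient

variable (k : Type*) [Field k] {V : Type*} [LinearOrder V] {G : SimpleGraph V} {r : ℕ}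
  (π : CliquePartition G r)

/-- The contribution of `x` to the differential of `(C, σ)`, up to sign. -/
noncomputable def pairFace (p : Finset (V ⊕ Fin r) × Finset V) (x : V) : PairModule k V r :=
  Finsupp.single (swapCover π p.1 x, p.2.erase x) (X (Sum.inr (π.part x))) -
    Finsupp.single (p.1, p.2.erase x) (X (Sum.inl x))

/-- The differential on the free module on all pairs `(C, σ)`. -/
noncomputable def pairDifferential :
    PairModule k V r →ₗ[MvPolynomial (V ⊕ Fin r) k] PairModule k V r :=
  Finsupp.linearCombination (MvPolynomial (V ⊕ Fin r) k) fun p =>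
    ∑ x ∈ p.2, (-1 : MvPolynomial (V ⊕ Fin r) k) ^ signExponent p.2 x • pairFace k π p x

theorem pairDifferential_single (p : Finset (V ⊕ Fin r) × Finset V)
    (q : MvPolynomial (V ⊕ Fin r) k) :
    pairDifferential k π (Finsupp.single p q) =
      ∑ x ∈ p.2, (-1 : MvPolynomial (V ⊕ Fin r) k) ^ signExponent p.2 x •
        (q • pairFace k π p x) := by
  rw [pairDifferential, Finsupp.linearCombination_single, Finset.smul_sum]
  exact Finset.sum_congr rfl fun x _ => smul_comm _ _ _

/-! ### Signs and the square of the differential -/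

theorem signExponent_erase_of_lt {σ : Finset V} {x y : V} (hx : x < y) :
    signExponent (σ.erase x) y = signExponent σ y := by
  unfold signExponent
  congr 1
  ext z
  simp only [Finset.mem_filter, Finset.mem_erase]
  exact ⟨fun h => ⟨h.1.2, h.2⟩, fun h => ⟨⟨(hx.trans h.2).ne', h.1⟩, h.2⟩⟩

theorem signExponent_erase_add_one {σ : Finset V} {x y : V} (hx : x < y) (hy : y ∈ σ) :
    signExponent (σ.erase y) x + 1 = signExponent σ x := by
  unfold signExponent
  rw [Finset.filter_erase, Finset.card_erase_add_one]
  simp [hx, hy]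

/-- Erasing the smaller vertex leaves the count at the larger one unchanged; erasing the larger
lowers the count at the smaller by one. -/
theorem sign_anticomm {R : Type*} [CommRing R] {σ : Finset V} {x y : V} (hx : x ∈ σ) (hy : y ∈ σ)
    (hxy : x ≠ y) :
    (-1 : R) ^ signExponent σ x * (-1) ^ signExponent (σ.erase x) y =
      -((-1) ^ signExponent σ y * (-1) ^ signExponent (σ.erase y) x) := by
  rcases lt_or_gt_of_ne hxy with h | h
  · rw [signExponent_erase_of_lt h, ← signExponent_erase_add_one h hy, pow_succ]
    ring
  · rw [signExponent_erase_of_lt h, ← signExponent_erase_add_one h hx, pow_succ]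
    ring

/-- The contribution of `x`, `y` to the square of the differential, up to sign. -/
noncomputable def pairDoubleFace (p : Finset (V ⊕ Fin r) × Finset V) (x y : V) :
    PairModule k V r :=
  (X (Sum.inr (π.part x)) : MvPolynomial (V ⊕ Fin r) k) •
      pairFace k π (swapCover π p.1 x, p.2.erase x) y -
    (X (Sum.inl x) : MvPolynomial (V ⊕ Fin r) k) • pairFace k π (p.1, p.2.erase x) y

theorem pairDoubleFace_comm (p : Finset (V ⊕ Fin r) × Finset V) (x y : V) :
    pairDoubleFace k π p x y = pairDoubleFace k π p y x := by
  simp only [pairDoubleFace, pairFace, smul_sub, Finsupp.smul_single, smul_eq_mul]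
  rw [swapCover_comm π p.1 x y, Finset.erase_right_comm (a := x) (b := y),
    mul_comm (X (Sum.inr (π.part x))) (X (Sum.inr (π.part y))),
    mul_comm (X (Sum.inl x)) (X (Sum.inl y)),
    mul_comm (X (Sum.inr (π.part x))) (X (Sum.inl y)),
    mul_comm (X (Sum.inl x)) (X (Sum.inr (π.part y)))]
  abel

theorem pairDifferential_pairFace (p : Finset (V ⊕ Fin r) × Finset V) (x : V) :
    pairDifferential k π (pairFace k π p x) =
      ∑ y ∈ p.2.erase x, (-1 : MvPolynomial (V ⊕ Fin r) k) ^ signExponent (p.2.erase x) y •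
        pairDoubleFace k π p x y := by
  rw [pairFace, map_sub, pairDifferential_single, pairDifferential_single,
    ← Finset.sum_sub_distrib]
  exact Finset.sum_congr rfl fun y _ => by rw [pairDoubleFace, smul_sub]

theorem pairDifferential_comp_self (f : PairModule k V r) :
    pairDifferential k π (pairDifferential k π f) = 0 := by
  induction f using Finsupp.induction_linear with
  | zero => simp
  | add f g hf hg => simp [hf, hg]
  | single p q =>
    have key : ∑ x ∈ p.2, (-1 : MvPolynomial (V ⊕ Fin r) k) ^ signExponent p.2 x •
        pairDifferential k π (pairFace k π p x) = 0 := by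
      simp only [pairDifferential_pairFace, Finset.smul_sum, smul_smul]
      rw [Finset.sum_sigma']
      -- The square is a sum over ordered pairs; `(x, y)` and `(y, x)` give the same double face
      -- with opposite signs.
      refine Finset.sum_involution (fun z _ => ⟨z.2, z.1⟩) ?_ ?_ ?_ ?_
      · rintro ⟨x, y⟩ h
        simp only [Finset.mem_sigma, Finset.mem_erase] at h
        simp only
        rw [sign_anticomm h.1 h.2.2 h.2.1.symm, pairDoubleFace_comm k π p x y, ← add_smul,
          neg_add_cancel, zero_smul]
      · rintro ⟨x, y⟩ h _ heq
        simp only [Finset.mem_sigma, Finset.mem_erase] at h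
        exact h.2.1 (congrArg Sigma.fst heq)
      · rintro ⟨x, y⟩ h
        simp only [Finset.mem_sigma, Finset.mem_erase] at h ⊢
        exact ⟨h.2.2, h.2.1.symm, h.1⟩
      · rintro ⟨x, y⟩ h
        rfl
    rw [pairDifferential_single, map_sum]
    simp only [map_smul]
    simp only [smul_comm _ q]
    rw [← Finset.smul_sum, key, smul_zero]

end Ambient

/-! ### Submodules spanned by monomial multiples of symbols -/

section MonomialSupport

variable (k : Type*) [Field k] {U P : Type*}

/-- The `k`-subspace spanned by the monomial multiples `m • p` with `(p, m) ∈ s`. -/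
def monomialSupported (s : Set (P × (U →₀ ℕ))) : Submodule k (P →₀ MvPolynomial U k) where
  carrier := {f | ∀ p m, coeff m (f p) ≠ 0 → (p, m) ∈ s}
  add_mem' {f g} hf hg p m h := by
    by_cases h1 : coeff m (f p) = 0
    · by_cases h2 : coeff m (g p) = 0
      · simp [h1, h2] at h
      · exact hg p m h2
    · exact hf p m h1
  zero_mem' p m h := by simp at h
  smul_mem' c f hf p m h := hf p m fun h0 => h (by simp [h0])

variable {k}

theorem mem_monomialSupported {s : Set (P × (U →₀ ℕ))} {f : P →₀ MvPolynomial U k} :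
    f ∈ monomialSupported k s ↔ ∀ p m, coeff m (f p) ≠ 0 → (p, m) ∈ s :=
  Iff.rfl

theorem monomialSupported_mono {s t : Set (P × (U →₀ ℕ))} (h : s ⊆ t) :
    monomialSupported k s ≤ monomialSupported k t :=
  fun _ hf p m hm => h (hf p m hm)

theorem single_monomial_mem_monomialSupported {s : Set (P × (U →₀ ℕ))} {p : P} {m : U →₀ ℕ}
    (h : (p, m) ∈ s) (c : k) : Finsupp.single p (monomial m c) ∈ monomialSupported k s := by
  classical
  intro p' m' h'
  rw [Finsupp.single_apply] at h'
  split_ifs at h' with h1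
  · rw [coeff_monomial] at h'
    split_ifs at h' with h2
    · rwa [← h1, ← h2]
    · simp at h'
  · simp at h'

/-- Since the homotopy is not linear over the polynomial ring, claims are reduced to monomial
multiples of symbols, which form a `k`-basis. -/
theorem map_mem_of_mem_monomialSupported {N : Type*} [AddCommGroup N] [Module k N]
    {s : Set (P × (U →₀ ℕ))} (Φ : (P →₀ MvPolynomial U k) →ₗ[k] N) {Q : Submodule k N}
    (h : ∀ p m, (p, m) ∈ s → Φ (Finsupp.single p (monomial m 1)) ∈ Q)
    {f : P →₀ MvPolynomial U k} (hf : f ∈ monomialSupported k s) : Φ f ∈ Q := by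
  rw [← Finsupp.sum_single f, Finsupp.sum, map_sum]
  refine Q.sum_mem fun p _ => ?_
  have hp : Finsupp.single p (f p) =
      ∑ m ∈ (f p).support, coeff m (f p) • Finsupp.single p (monomial m (1 : k)) := by
    conv_lhs => rw [(f p).as_sum, ← Finsupp.singleAddHom_apply, map_sum]
    refine Finset.sum_congr rfl fun m _ => ?_
    rw [Finsupp.singleAddHom_apply, Finsupp.smul_single, smul_monomial, smul_eq_mul, mul_one]
  rw [hp, map_sum]
  refine Q.sum_mem fun m hm => ?_
  rw [map_smul]
  exact Q.smul_mem _ (h p m (hf p m (mem_support_iff.1 hm)))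

end MonomialSupport

/-! ### Symbols as pairs and the contracting homotopy -/

section Homotopy

variable (k : Type*) [Field k] {V : Type*} [LinearOrder V] {G : SimpleGraph V} {r : ℕ}
  (π : CliquePartition G r)

/-- The pair `(C, σ)` underlies a basis symbol of homological degree `i`. -/
def IsSymbolPair (i : ℕ) (p : Finset (V ⊕ Fin r) × Finset V) : Prop :=
  IsMinVertexCover (cliqueWhiskered π) p.1 ∧ (∀ v ∈ p.2, Sum.inl v ∉ p.1) ∧ p.2.card = i

variable {π}

theorem IsSymbolPair.swap {i : ℕ} {p : Finset (V ⊕ Fin r) × Finset V}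
    (hp : IsSymbolPair π (i + 1) p) {x : V} (hx : x ∈ p.2) :
    IsSymbolPair π i (swapCover π p.1 x, p.2.erase x) := by
  refine ⟨hp.1.swap (hp.2.1 x hx), fun v hv => ?_, by simp [Finset.card_erase_of_mem hx, hp.2.2]⟩
  have h1 := hp.2.1 v (Finset.mem_of_mem_erase hv)
  have h2 := Finset.ne_of_mem_erase hv
  simp [swapCover, h1, h2]

theorem IsSymbolPair.drop {i : ℕ} {p : Finset (V ⊕ Fin r) × Finset V}
    (hp : IsSymbolPair π (i + 1) p) {x : V} (hx : x ∈ p.2) :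
    IsSymbolPair π i (p.1, p.2.erase x) :=
  ⟨hp.1, fun v hv => hp.2.1 v (Finset.mem_of_mem_erase hv), by
    simp [Finset.card_erase_of_mem hx, hp.2.2]⟩

theorem IsSymbolPair.insert {i : ℕ} {p : Finset (V ⊕ Fin r) × Finset V}
    (hp : IsSymbolPair π i p) {x : V} (hx : Sum.inl x ∉ p.1) (hxs : x ∉ p.2) :
    IsSymbolPair π (i + 1) (p.1, Insert.insert x p.2) := by
  refine ⟨hp.1, fun v hv => ?_, by simp [Finset.card_insert_of_notMem hxs, hp.2.2]⟩
  rcases Finset.mem_insert.1 hv with rfl | hv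
  · exact hx
  · exact hp.2.1 v hv

/-! ### The level filtration and the contracting homotopy -/

variable [Fintype V]

/-- The number of vertices of `G` outside of `C`. -/
def pairLevel (p : Finset (V ⊕ Fin r) × Finset V) : ℕ :=
  (Finset.univ.filter fun v => Sum.inl v ∉ p.1).card

/-- The swap brings `x` into the cover, and the whisker it removes is not counted. This makes the
swap terms of the differential negligible. -/
theorem pairLevel_swap_lt (π : CliquePartition G r) {p : Finset (V ⊕ Fin r) × Finset V} {x : V}
    (hx : Sum.inl x ∉ p.1) (σ : Finset V) : pairLevel (swapCover π p.1 x, σ) < pairLevel p := by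
  refine Finset.card_lt_card ((Finset.ssubset_iff_of_subset fun v hv => ?_).2 ⟨x, ?_, ?_⟩)
  · simp only [swapCover, Finset.mem_filter, Finset.mem_univ, true_and, Finset.mem_insert,
      Finset.mem_erase, ne_eq, reduceCtorEq, not_false_eq_true] at hv ⊢
    tauto
  · simpa using hx
  · simp [swapCover]

/-- The vertices outside of `C` that divide `m · x_σ`. -/
def activeSet (p : Finset (V ⊕ Fin r) × Finset V) (m : (V ⊕ Fin r) →₀ ℕ) : Finset V :=
  Finset.univ.filter fun v => Sum.inl v ∉ p.1 ∧ (v ∈ p.2 ∨ m (Sum.inl v) ≠ 0)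

theorem mem_activeSet {p : Finset (V ⊕ Fin r) × Finset V} {m : (V ⊕ Fin r) →₀ ℕ} {v : V} :
    v ∈ activeSet p m ↔ Sum.inl v ∉ p.1 ∧ (v ∈ p.2 ∨ m (Sum.inl v) ≠ 0) := by
  simp [activeSet]

/-- The vertex `y` moves from the face to the monomial, so it stays active. Hence the least active
vertex is constant along the Koszul part of the differential. -/
theorem activeSet_drop {p : Finset (V ⊕ Fin r) × Finset V} {m : (V ⊕ Fin r) →₀ ℕ} {y : V}
    (hy : y ∈ p.2) :
    activeSet (p.1, p.2.erase y) (m + Finsupp.single (Sum.inl y) 1) = activeSet p m := by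
  ext v
  simp only [mem_activeSet, Finset.mem_erase, Finsupp.add_apply]
  by_cases h : v = y
  · subst h; simp [hy]
  · simp [h]

/-- The value of the homotopy on the monomial multiple `m • (C, σ)`: with `x` the least active
vertex, it is zero if `x ∈ σ`, and `± (m / x) • (C, σ ∪ {x})` otherwise. -/
noncomputable def homotopyValue (p : Finset (V ⊕ Fin r) × Finset V) (m : (V ⊕ Fin r) →₀ ℕ) :
    PairModule k V r :=
  if h : (activeSet p m).Nonempty then
    if (activeSet p m).min' h ∈ p.2 then 0
    else (-1 : MvPolynomial (V ⊕ Fin r) k) ^ (p.2.card + 1) •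
      Finsupp.single (p.1, insert ((activeSet p m).min' h) p.2)
        (monomial (m - Finsupp.single (Sum.inl ((activeSet p m).min' h)) 1) 1)
  else 0

/-- The contracting homotopy, up to terms of lower level. -/
noncomputable def pairHomotopy : PairModule k V r →ₗ[k] PairModule k V r :=
  Finsupp.lsum k fun p => (basisMonomials (V ⊕ Fin r) k).constr k (homotopyValue k p)

variable {k}

theorem pairHomotopy_single (p : Finset (V ⊕ Fin r) × Finset V) (m : (V ⊕ Fin r) →₀ ℕ) :
    pairHomotopy k (Finsupp.single p (monomial m 1)) = homotopyValue k p m := by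
  rw [pairHomotopy, Finsupp.lsum_single,
    ← show basisMonomials (V ⊕ Fin r) k m = monomial m 1 from congrFun (coe_basisMonomials _ _) m,
    Module.Basis.constr_basis]

theorem homotopyValue_of_eq_empty {p : Finset (V ⊕ Fin r) × Finset V} {m : (V ⊕ Fin r) →₀ ℕ}
    (h : activeSet p m = ∅) : homotopyValue k p m = 0 := by
  simp [homotopyValue, h]

theorem homotopyValue_of_isLeast_of_mem {p : Finset (V ⊕ Fin r) × Finset V}
    {m : (V ⊕ Fin r) →₀ ℕ} {x : V} (hx : IsLeast (activeSet p m : Set V) x) (hxs : x ∈ p.2) :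
    homotopyValue k p m = 0 := by
  have hne : (activeSet p m).Nonempty := ⟨x, hx.1⟩
  have : (activeSet p m).min' hne = x := (Finset.isLeast_min' _ hne).unique hx
  rw [homotopyValue, dif_pos hne, this, if_pos hxs]

theorem homotopyValue_of_isLeast_of_notMem {p : Finset (V ⊕ Fin r) × Finset V}
    {m : (V ⊕ Fin r) →₀ ℕ} {x : V} (hx : IsLeast (activeSet p m : Set V) x) (hxs : x ∉ p.2) :
    homotopyValue k p m = (-1 : MvPolynomial (V ⊕ Fin r) k) ^ (p.2.card + 1) •
      Finsupp.single (p.1, insert x p.2) (monomial (m - Finsupp.single (Sum.inl x) 1) 1) := by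
  have hne : (activeSet p m).Nonempty := ⟨x, hx.1⟩
  have : (activeSet p m).min' hne = x := (Finset.isLeast_min' _ hne).unique hx
  rw [homotopyValue, dif_pos hne, this, if_neg hxs]

/-- Signs are scalars of the polynomial ring, while the homotopy and its target subspaces are only
`k`-linear; this lemma and the next bridge the gap. -/
theorem neg_one_pow_smul_mem {R k M : Type*} [CommRing R] [Ring k] [AddCommGroup M] [Module R M]
    [Module k M] (Q : Submodule k M) {f : M} (hf : f ∈ Q) (n : ℕ) : (-1 : R) ^ n • f ∈ Q := by
  rcases neg_one_pow_eq_or R n with h | h <;> simp [h, hf]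

theorem map_neg_one_pow_smul {R M N : Type*} [CommRing R] [AddCommGroup M] [AddCommGroup N]
    [Module R M] [Module R N] {F : Type*} [FunLike F M N] [AddMonoidHomClass F M N] (Φ : F)
    (n : ℕ) (f : M) : Φ ((-1 : R) ^ n • f) = (-1 : R) ^ n • Φ f := by
  rcases neg_one_pow_eq_or R n with h | h <;> simp [h]

/-- The homotopy leaves `C` alone, so it preserves the level. -/
theorem homotopyValue_mem {i n : ℕ} {p : Finset (V ⊕ Fin r) × Finset V} {m : (V ⊕ Fin r) →₀ ℕ}
    (hp : IsSymbolPair π i p) (hn : pairLevel p < n) :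
    homotopyValue k p m ∈ monomialSupported k
      {z : _ × ((V ⊕ Fin r) →₀ ℕ) | IsSymbolPair π (i + 1) z.1 ∧ pairLevel z.1 < n} := by
  rcases (activeSet p m).eq_empty_or_nonempty with h | h
  · rw [homotopyValue_of_eq_empty h]; exact Submodule.zero_mem _
  · have hx := Finset.isLeast_min' _ h
    by_cases hxs : (activeSet p m).min' h ∈ p.2
    · rw [homotopyValue_of_isLeast_of_mem hx hxs]; exact Submodule.zero_mem _
    · rw [homotopyValue_of_isLeast_of_notMem hx hxs]
      refine neg_one_pow_smul_mem _ (single_monomial_mem_monomialSupported ?_ 1) _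
      exact ⟨hp.insert (mem_activeSet.1 hx.1).1 hxs, hn⟩

/-! ### The homotopy identity modulo lower levels -/

omit [Fintype V] in
theorem pairDifferential_single_monomial (p : Finset (V ⊕ Fin r) × Finset V)
    (m : (V ⊕ Fin r) →₀ ℕ) :
    pairDifferential k π (Finsupp.single p (monomial m 1)) =
      ∑ y ∈ p.2, (-1 : MvPolynomial (V ⊕ Fin r) k) ^ signExponent p.2 y •
        (Finsupp.single (swapCover π p.1 y, p.2.erase y)
            (monomial (m + Finsupp.single (Sum.inr (π.part y)) 1) 1) -
          Finsupp.single (p.1, p.2.erase y) (monomial (m + Finsupp.single (Sum.inl y) 1) 1)) := by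
  rw [pairDifferential_single]
  refine Finset.sum_congr rfl fun y _ => ?_
  simp only [pairFace, smul_sub, Finsupp.smul_single, smul_eq_mul, X, monomial_mul, mul_one]

theorem pairHomotopy_pairDifferential (p : Finset (V ⊕ Fin r) × Finset V)
    (m : (V ⊕ Fin r) →₀ ℕ) :
    pairHomotopy k (pairDifferential k π (Finsupp.single p (monomial m 1))) =
      ∑ y ∈ p.2, (-1 : MvPolynomial (V ⊕ Fin r) k) ^ signExponent p.2 y •
        (homotopyValue k (swapCover π p.1 y, p.2.erase y)
            (m + Finsupp.single (Sum.inr (π.part y)) 1) -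
          homotopyValue k (p.1, p.2.erase y) (m + Finsupp.single (Sum.inl y) 1)) := by
  rw [pairDifferential_single_monomial, map_sum]
  refine Finset.sum_congr rfl fun y _ => ?_
  rw [map_neg_one_pow_smul, map_sub, pairHomotopy_single, pairHomotopy_single]

omit [Fintype V] in
theorem signExponent_of_isLeast {σ : Finset V} {x : V} (hx : ∀ y ∈ σ, x ≤ y) :
    signExponent σ x = (σ.erase x).card := by
  unfold signExponent
  congr 1
  ext y
  simp only [Finset.mem_filter, Finset.mem_erase]
  exact ⟨fun h => ⟨h.2.ne', h.1⟩, fun h => ⟨h.2, lt_of_le_of_ne (hx y h.2) h.1.symm⟩⟩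

/-- Here the homotopy kills the symbol itself, and applying it after the differential restores the
symbol from the face that drops `x`. -/
theorem homotopy_identity_of_mem {i : ℕ} {p : Finset (V ⊕ Fin r) × Finset V}
    {m : (V ⊕ Fin r) →₀ ℕ} (hp : IsSymbolPair π i p) {x : V}
    (hx : IsLeast (activeSet p m : Set V) x) (hxs : x ∈ p.2) :
    pairDifferential k π (pairHomotopy k (Finsupp.single p (monomial m 1))) +
      pairHomotopy k (pairDifferential k π (Finsupp.single p (monomial m 1))) -
        Finsupp.single p (monomial m 1) ∈ monomialSupported k
          {z : _ × ((V ⊕ Fin r) →₀ ℕ) | IsSymbolPair π i z.1 ∧ pairLevel z.1 < pairLevel p} := by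
  rw [pairHomotopy_single, homotopyValue_of_isLeast_of_mem hx hxs, map_zero, zero_add,
    pairHomotopy_pairDifferential]
  simp only [smul_sub, Finset.sum_sub_distrib]
  have hle : ∀ y ∈ p.2, x ≤ y := fun y hy => hx.2 (mem_activeSet.2 ⟨hp.2.1 y hy, Or.inl hy⟩)
  have hdrop : ∑ y ∈ p.2, (-1 : MvPolynomial (V ⊕ Fin r) k) ^ signExponent p.2 y •
      homotopyValue k (p.1, p.2.erase y) (m + Finsupp.single (Sum.inl y) 1) =
        -(Finsupp.single p (monomial m 1) : PairModule k V r) := by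
    -- For `y ≠ x` the least active vertex `x` still lies in `σ ∖ {y}`, so the homotopy vanishes
    -- there.
    rw [Finset.sum_eq_single_of_mem x hxs]
    · rw [homotopyValue_of_isLeast_of_notMem (x := x) (by rwa [activeSet_drop hxs]) (by simp),
        smul_smul, ← pow_add, signExponent_of_isLeast hle, Finset.insert_erase hxs,
        add_tsub_cancel_right, ← add_assoc, pow_succ, ← two_mul, pow_mul]
      simp
    · intro y hy hyx
      rw [homotopyValue_of_isLeast_of_mem (x := x) (by rwa [activeSet_drop hy])
        (Finset.mem_erase.2 ⟨hyx.symm, hxs⟩), smul_zero]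
  rw [hdrop, sub_neg_eq_add, add_sub_cancel_right]
  refine Submodule.sum_mem _ fun y hy => neg_one_pow_smul_mem _ ?_ _
  obtain ⟨j, rfl⟩ : ∃ j, i = j + 1 :=
    Nat.exists_eq_succ_of_ne_zero fun h => by
      have := hp.2.2
      rw [h, Finset.card_eq_zero] at this
      simp [this] at hy
  exact homotopyValue_mem (hp.swap hy) (pairLevel_swap_lt π (hp.2.1 y hy) _)

/-- The face of `(C, σ ∪ {x})` dropping `x` returns the symbol; faces dropping `y ∈ σ` cancel
between the two composites; all swaps have lower level. -/
theorem homotopy_identity_of_notMem {i : ℕ} {p : Finset (V ⊕ Fin r) × Finset V}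
    {m : (V ⊕ Fin r) →₀ ℕ} (hp : IsSymbolPair π i p) {x : V}
    (hx : IsLeast (activeSet p m : Set V) x) (hxs : x ∉ p.2) :
    pairDifferential k π (pairHomotopy k (Finsupp.single p (monomial m 1))) +
      pairHomotopy k (pairDifferential k π (Finsupp.single p (monomial m 1))) -
        Finsupp.single p (monomial m 1) ∈ monomialSupported k
          {z : _ × ((V ⊕ Fin r) →₀ ℕ) | IsSymbolPair π i z.1 ∧ pairLevel z.1 < pairLevel p} := by
  obtain ⟨hxC, hxm⟩ := mem_activeSet.1 hx.1
  replace hxm := hxm.resolve_left hxs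
  have hlt : ∀ y ∈ p.2, x < y := fun y hy =>
    lt_of_le_of_ne (hx.2 (mem_activeSet.2 ⟨hp.2.1 y hy, Or.inl hy⟩)) fun h => hxs (h ▸ hy)
  have hxle : Finsupp.single (Sum.inl x) 1 ≤ m :=
    Finsupp.single_le_iff.2 (Nat.one_le_iff_ne_zero.2 hxm)
  have hins := hp.insert hxC hxs
  set Q := monomialSupported k
    {z : _ × ((V ⊕ Fin r) →₀ ℕ) | IsSymbolPair π i z.1 ∧ pairLevel z.1 < pairLevel p}
  have hsgn : ∀ y ∈ p.2, signExponent (insert x p.2) y = signExponent p.2 y := fun y hy => by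
    rw [← signExponent_erase_of_lt (hlt y hy), Finset.erase_insert hxs]
  have hsgnx : signExponent (insert x p.2) x = p.2.card := by
    rw [signExponent_of_isLeast, Finset.erase_insert hxs]
    intro y hy
    rcases Finset.mem_insert.1 hy with rfl | hy
    · exact le_rfl
    · exact (hlt y hy).le
  rw [pairHomotopy_single, homotopyValue_of_isLeast_of_notMem hx hxs, map_smul,
    pairHomotopy_pairDifferential, pairDifferential_single_monomial, Finset.sum_insert hxs,
    hsgnx, Finset.erase_insert hxs, tsub_add_cancel_of_le hxle, smul_add, smul_smul, ← pow_add,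
    Finset.smul_sum]
  -- The homotopy contributes `|σ| + 1` and the differential `|σ|`, as `x` lies below all of `σ`.
  -- The odd total offsets the minus sign of the drop term.
  have hodd : (-1 : MvPolynomial (V ⊕ Fin r) k) ^ (p.2.card + 1 + p.2.card) = -1 := by
    rw [add_right_comm, pow_succ, ← two_mul, pow_mul]
    simp
  rw [hodd, neg_one_smul, neg_sub, add_assoc, ← Finset.sum_add_distrib, sub_add_eq_add_sub,
    sub_right_comm, add_sub_cancel_left]
  refine Q.sub_mem (Q.sum_mem fun y hy => ?_)
    (single_monomial_mem_monomialSupported ?_ 1)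
  · obtain ⟨j, rfl⟩ : ∃ j, i = j + 1 :=
      Nat.exists_eq_succ_of_ne_zero fun h => by
        have := hp.2.2
        rw [h, Finset.card_eq_zero] at this
        simp [this] at hy
    have hyx : y ≠ x := (hlt y hy).ne'
    have hyC := hp.2.1 y hy
    rw [homotopyValue_of_isLeast_of_notMem (p := (p.1, p.2.erase y)) (x := x)
        (by rwa [activeSet_drop hy]) (fun h => hxs (Finset.mem_of_mem_erase h)),
      hsgn y hy, ← Finset.erase_insert_of_ne hyx.symm, tsub_add_eq_add_tsub hxle,
      tsub_add_eq_add_tsub hxle, Finset.card_erase_add_one hy]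
    -- Here `b` is the drop term common to both composites, while `a` and `c` come from swaps.
    have hcancel : ∀ (a b c : PairModule k V r) (s : MvPolynomial (V ⊕ Fin r) k) (n : ℕ),
        (-1 : MvPolynomial (V ⊕ Fin r) k) ^ (n + 1) • s • (a - b) + s • (c - (-1 : MvPolynomial (V ⊕ Fin r) k) ^ n • b) =
          (-1 : MvPolynomial (V ⊕ Fin r) k) ^ (n + 1) • s • a + s • c := by
      intro a b c s n
      rw [smul_sub, smul_sub, smul_sub, smul_smul s, pow_succ, smul_smul _ s b]
      rw [show (-1 : MvPolynomial (V ⊕ Fin r) k) ^ n * -1 * s = -(s * (-1) ^ n) by ring, neg_smul]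
      abel
    rw [hcancel]
    refine Q.add_mem (neg_one_pow_smul_mem Q (neg_one_pow_smul_mem Q
      (single_monomial_mem_monomialSupported ?_ 1) _) _)
      (neg_one_pow_smul_mem Q ?_ _)
    · exact ⟨hins.swap (Finset.mem_insert_of_mem hy), pairLevel_swap_lt π hyC _⟩
    · exact homotopyValue_mem (hp.swap hy) (pairLevel_swap_lt π hyC _)
  · have := hins.swap (Finset.mem_insert_self x p.2)
    rw [Finset.erase_insert hxs] at this
    exact ⟨this, pairLevel_swap_lt π hxC _⟩

/-- Up to terms of lower level and terms without active vertices, the homotopy is contracting. -/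
theorem homotopy_identity {i n : ℕ} {f : PairModule k V r}
    (hf : f ∈ monomialSupported k
      {z : _ × ((V ⊕ Fin r) →₀ ℕ) | IsSymbolPair π i z.1 ∧ pairLevel z.1 < n + 1}) :
    pairDifferential k π (pairHomotopy k f) + pairHomotopy k (pairDifferential k π f) - f ∈
      monomialSupported k
          {z : _ × ((V ⊕ Fin r) →₀ ℕ) | IsSymbolPair π i z.1 ∧ pairLevel z.1 < n} ⊔
        monomialSupported k {z | IsSymbolPair π i z.1 ∧ activeSet z.1 z.2 = ∅} := by
  let D : PairModule k V r →ₗ[k] PairModule k V r := (pairDifferential k π).restrictScalars k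
  refine map_mem_of_mem_monomialSupported
    (D ∘ₗ pairHomotopy k + pairHomotopy k ∘ₗ D - LinearMap.id) (fun p m hp => ?_) hf
  change pairDifferential k π (pairHomotopy k (Finsupp.single p (monomial m 1))) +
    pairHomotopy k (pairDifferential k π (Finsupp.single p (monomial m 1))) -
      Finsupp.single p (monomial m 1) ∈ _
  have hmono : monomialSupported k {z : _ × ((V ⊕ Fin r) →₀ ℕ) |
      IsSymbolPair π i z.1 ∧ pairLevel z.1 < pairLevel p} ≤ monomialSupported k
        {z : _ × ((V ⊕ Fin r) →₀ ℕ) | IsSymbolPair π i z.1 ∧ pairLevel z.1 < n} :=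
    monomialSupported_mono fun z hz => ⟨hz.1, hz.2.trans_le (Nat.lt_succ_iff.1 hp.2)⟩
  rcases (activeSet p m).eq_empty_or_nonempty with h | h
  -- Without active vertices the face is empty, so both composites vanish and only the negative of
  -- the residual term is left.
  · have hσ : p.2 = ∅ := Finset.eq_empty_of_forall_notMem fun v hv => by
      have : v ∈ activeSet p m := mem_activeSet.2 ⟨hp.1.2.1 v hv, Or.inl hv⟩
      simp [h] at this
    rw [pairHomotopy_single, homotopyValue_of_eq_empty h, pairDifferential_single_monomial, hσ,
      Finset.sum_empty, map_zero, map_zero, zero_add, zero_sub]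
    exact Submodule.mem_sup_right
      (Submodule.neg_mem _ (single_monomial_mem_monomialSupported (by exact ⟨hp.1, h⟩) 1))
  · have hx := Finset.isLeast_min' _ h
    refine Submodule.mem_sup_left (hmono ?_)
    by_cases hxs : (activeSet p m).min' h ∈ p.2
    · exact homotopy_identity_of_mem hp.1 hx hxs
    · exact homotopy_identity_of_notMem hp.1 hx hxs

theorem pairDifferential_eq_zero_of_mem {i : ℕ} {f : PairModule k V r}
    (hf : f ∈ monomialSupported k
      {z : _ × ((V ⊕ Fin r) →₀ ℕ) | IsSymbolPair π i z.1 ∧ activeSet z.1 z.2 = ∅}) :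
    pairDifferential k π f = 0 := by
  rw [← Submodule.mem_bot k]
  refine map_mem_of_mem_monomialSupported ((pairDifferential k π).restrictScalars k)
    (fun p m hp => ?_) hf
  have hσ : p.2 = ∅ := Finset.eq_empty_of_forall_notMem fun v hv => by
    have h : v ∈ activeSet p m := mem_activeSet.2 ⟨hp.1.2.1 v hv, Or.inl hv⟩
    simp [hp.2] at h
  rw [LinearMap.restrictScalars_apply, pairDifferential_single_monomial, hσ, Finset.sum_empty]
  exact Submodule.zero_mem _

/-- Every cycle is a boundary up to terms without active vertices. -/
theorem exists_eq_pairDifferential_add {i : ℕ} (n : ℕ) {f : PairModule k V r}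
    (hf : f ∈ monomialSupported k
      {z : _ × ((V ⊕ Fin r) →₀ ℕ) | IsSymbolPair π i z.1 ∧ pairLevel z.1 < n})
    (hd : pairDifferential k π f = 0) :
    ∃ g ∈ monomialSupported k {z : _ × ((V ⊕ Fin r) →₀ ℕ) | IsSymbolPair π (i + 1) z.1},
      f - pairDifferential k π g ∈ monomialSupported k
        {z : _ × ((V ⊕ Fin r) →₀ ℕ) | IsSymbolPair π i z.1 ∧ activeSet z.1 z.2 = ∅} := by
  induction n generalizing f with
  | zero =>
    refine ⟨0, Submodule.zero_mem _, ?_⟩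
    rw [map_zero, sub_zero]
    exact monomialSupported_mono (fun z hz => absurd hz.2 (Nat.not_lt_zero _)) hf
  | succ n ih =>
    obtain ⟨l, hl, u, hu, hlu⟩ := Submodule.mem_sup.1 (homotopy_identity hf)
    rw [hd, map_zero, add_zero] at hlu
    -- The differential kills both sides' other terms in `l + u = d h f - f`, so `l` is a cycle of
    -- lower level and the induction applies.
    have hdl : pairDifferential k π l = 0 := by
      have h := congrArg (pairDifferential k π) hlu
      rwa [map_add, map_sub, hd, pairDifferential_comp_self, sub_zero,
        pairDifferential_eq_zero_of_mem hu, add_zero] at h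
    obtain ⟨g, hg, hlg⟩ := ih hl hdl
    have hH : pairHomotopy k f ∈ monomialSupported k
        {z : _ × ((V ⊕ Fin r) →₀ ℕ) | IsSymbolPair π (i + 1) z.1} :=
      map_mem_of_mem_monomialSupported (pairHomotopy k) (fun p m hp => by
        rw [pairHomotopy_single]
        exact monomialSupported_mono (fun z hz => hz.1) (homotopyValue_mem hp.1 hp.2)) hf
    refine ⟨pairHomotopy k f - g, Submodule.sub_mem _ hH hg, ?_⟩
    have : f - pairDifferential k π (pairHomotopy k f - g) =
        -(l - pairDifferential k π g) - u := by
      rw [map_sub, eq_sub_of_add_eq' hlu]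
      abel
    rw [this]
    exact Submodule.sub_mem _ (Submodule.neg_mem _ hlg) hu

end Homotopy

/-! ### Comparison of the resolution with the ambient complex -/

theorem IsMinVertexCover.inr_mem_iff {V : Type*} [DecidableEq V] {G : SimpleGraph V} {r : ℕ}
    {π : CliquePartition G r} {C : Finset (V ⊕ Fin r)}
    (hC : IsMinVertexCover (cliqueWhiskered π) C) (j : Fin r) :
    Sum.inr j ∈ C ↔ ∃ z, π.part z = j ∧ Sum.inl z ∉ C := by
  refine ⟨hC.exists_inl_notMem, ?_⟩
  rintro ⟨z, rfl, hz⟩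
  exact (((cliqueWhiskered_isVertexCover_iff π C).1 hC.prop).2 z).resolve_left hz

/-- In a minimal cover a whisker is present exactly when its part is not wholly covered, so the
vertices of `G` determine the rest. -/
theorem IsMinVertexCover.eq_of_inl {V : Type*} [DecidableEq V] {G : SimpleGraph V} {r : ℕ}
    {π : CliquePartition G r} {C D : Finset (V ⊕ Fin r)}
    (hC : IsMinVertexCover (cliqueWhiskered π) C) (hD : IsMinVertexCover (cliqueWhiskered π) D)
    (h : ∀ v, Sum.inl v ∈ C ↔ Sum.inl v ∈ D) : C = D := by
  ext u
  rcases u with v | j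
  · exact h v
  · rw [hC.inr_mem_iff, hD.inr_mem_iff]
    simp only [h]

/-- The exponent vector of the squarefree monomial `z_C`. -/
theorem coverMonomial_eq_monomial (k : Type*) [Field k] {U : Type*} (C : Finset U) :
    coverMonomial k C = monomial (∑ u ∈ C, Finsupp.single u 1) 1 := by
  rw [coverMonomial, monomial_sum_one]
  rfl

namespace BasisSymbol

variable {V : Type*} {G : SimpleGraph V} {r : ℕ} {π : CliquePartition G r}

/-- The pair `(C, σ)` underlying a basis symbol. -/
def toPair {i : ℕ} (f : BasisSymbol π i) : Finset (V ⊕ Fin r) × Finset V := (f.cover, f.face)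

theorem toPair_injective (i : ℕ) : Function.Injective (toPair : BasisSymbol π i → _) :=
  fun _ _ h => BasisSymbol.ext (congrArg Prod.fst h) (congrArg Prod.snd h)

theorem face_eq_empty (f : BasisSymbol π 0) : f.face = ∅ := Finset.card_eq_zero.1 f.card_face

/-- The whisker edge at `x` must be covered. Thus a swap really deletes `w_j`, which the multidegree
count needs. -/
theorem inr_mem_cover {i : ℕ} (f : BasisSymbol π i) {x : V} (hx : x ∈ f.face) :
    Sum.inr (π.part x) ∈ f.cover :=
  (((cliqueWhiskered_isVertexCover_iff π f.cover).1 f.isMin.prop).2 x).resolve_left (f.notMem x hx)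

theorem sum_face_erase [DecidableEq V] {i : ℕ} (f : BasisSymbol π i) {x : V} (hx : x ∈ f.face) :
    (∑ v ∈ f.face.erase x, Finsupp.single (Sum.inl v) 1) + Finsupp.single (Sum.inl x) 1 =
      (∑ v ∈ f.face, Finsupp.single (Sum.inl v) 1 : (V ⊕ Fin r) →₀ ℕ) :=
  Finset.sum_erase_add _ _ hx

theorem single_add_multidegree_drop [DecidableEq V] {i : ℕ} (f : BasisSymbol π (i + 1)) (x : V)
    (hx : x ∈ f.face) :
    Finsupp.single (Sum.inl x) 1 + (f.drop x hx).multidegree = f.multidegree := by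
  rw [multidegree, multidegree, ← f.sum_face_erase hx]
  simp only [drop]
  abel

theorem single_add_multidegree_swap [DecidableEq V] {i : ℕ} (f : BasisSymbol π (i + 1)) (x : V)
    (hx : x ∈ f.face) :
    Finsupp.single (Sum.inr (π.part x)) 1 + (f.swap x hx).multidegree = f.multidegree := by
  rw [multidegree, multidegree, ← f.sum_face_erase hx,
    ← Finset.sum_erase_add _ _ (f.inr_mem_cover hx)]
  simp only [swap]
  rw [Finset.sum_insert (by simp [f.notMem x hx])]
  abel

theorem X_mul_coverMonomial_swap (k : Type*) [Field k] [DecidableEq V] {i : ℕ}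
    (f : BasisSymbol π (i + 1)) (x : V) (hx : x ∈ f.face) :
    X (Sum.inr (π.part x)) * coverMonomial k (f.swap x hx).cover =
      X (Sum.inl x) * coverMonomial k (f.drop x hx).cover := by
  simp only [swap, drop, coverMonomial]
  rw [Finset.prod_insert (by simp [f.notMem x hx]), ← Finset.mul_prod_erase _ _ (f.inr_mem_cover hx)]
  ring

instance finite [Finite V] (i : ℕ) : Finite (BasisSymbol π i) :=
  Finite.of_injective _ (toPair_injective i)

end BasisSymbol

/-! ### Multihomogeneous elements of a free module -/

section Multihomogeneous

variable {k U B : Type*} [Field k] {deg : B → (U →₀ ℕ)} {a : U →₀ ℕ}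

theorem IsMultihomogeneous.zero : IsMultihomogeneous (k := k) deg a 0 := fun b m hm => by simp at hm

theorem IsMultihomogeneous.add {f g : B →₀ MvPolynomial U k} (hf : IsMultihomogeneous deg a f)
    (hg : IsMultihomogeneous deg a g) : IsMultihomogeneous deg a (f + g) := by
  classical
  intro b m hm
  rcases Finset.mem_union.1 (support_add hm) with h | h
  · exact hf b m h
  · exact hg b m h

theorem IsMultihomogeneous.neg {f : B →₀ MvPolynomial U k} (hf : IsMultihomogeneous deg a f) :
    IsMultihomogeneous deg a (-f) := fun b m hm =>
  hf b m (by simpa [mem_support_iff] using hm)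

theorem IsMultihomogeneous.sum {ι : Type*} {s : Finset ι} {f : ι → B →₀ MvPolynomial U k}
    (hf : ∀ i ∈ s, IsMultihomogeneous deg a (f i)) : IsMultihomogeneous deg a (∑ i ∈ s, f i) :=
  Finset.sum_induction f _ (fun _ _ => IsMultihomogeneous.add) IsMultihomogeneous.zero hf

theorem isMultihomogeneous_single_mul_X {b : B} {p : MvPolynomial U k} {u : U}
    (h : ∀ m ∈ p.support, m + (Finsupp.single u 1 + deg b) = a) :
    IsMultihomogeneous deg a (Finsupp.single b (p * X u)) := by
  classical
  intro c m hm
  rw [Finsupp.single_apply] at hm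
  split_ifs at hm with hbc
  · subst hbc
    rw [support_mul_X] at hm
    obtain ⟨m', hm', rfl⟩ := Finset.mem_map.1 hm
    rw [addRightEmbedding_apply, add_assoc]
    exact h m' hm'
  · simp at hm

end Multihomogeneous

/-! ### The resolution: complex, homogeneity, minimality, surjectivity -/

section Resolution

variable (k : Type*) [Field k] {V : Type*} [LinearOrder V] {G : SimpleGraph V} {r : ℕ}
  (π : CliquePartition G r)

/-- The embedding of the resolution into the ambient complex. -/
noncomputable def toPairModule (i : ℕ) :
    (BasisSymbol π i →₀ MvPolynomial (V ⊕ Fin r) k) →ₗ[MvPolynomial (V ⊕ Fin r) k]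
      PairModule k V r :=
  Finsupp.lmapDomain _ _ BasisSymbol.toPair

omit [LinearOrder V] in
theorem toPairModule_injective (i : ℕ) : Function.Injective (toPairModule k π i) :=
  Finsupp.mapDomain_injective (BasisSymbol.toPair_injective i)

omit [LinearOrder V] in
theorem toPairModule_single {i : ℕ} (b : BasisSymbol π i) (q : MvPolynomial (V ⊕ Fin r) k) :
    toPairModule k π i (Finsupp.single b q) = Finsupp.single b.toPair q :=
  Finsupp.mapDomain_single

omit [LinearOrder V] in
theorem toPairModule_apply {i : ℕ} (f : BasisSymbol π i →₀ MvPolynomial (V ⊕ Fin r) k)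
    (b : BasisSymbol π i) : toPairModule k π i f b.toPair = f b :=
  Finsupp.mapDomain_apply (BasisSymbol.toPair_injective i) f b

theorem resolutionDifferential_single {i : ℕ} (b : BasisSymbol π (i + 1))
    (q : MvPolynomial (V ⊕ Fin r) k) :
    resolutionDifferential k π i (Finsupp.single b q) =
      ∑ x ∈ b.face.attach, (-1 : MvPolynomial (V ⊕ Fin r) k) ^ signExponent b.face x.1 •
        (Finsupp.single (b.swap x.1 x.2) (q * X (Sum.inr (π.part x.1))) -
          Finsupp.single (b.drop x.1 x.2) (q * X (Sum.inl x.1))) := by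
  rw [resolutionDifferential, Finsupp.linearCombination_single, Finset.smul_sum]
  refine Finset.sum_congr rfl fun x _ => ?_
  rw [smul_comm, smul_sub, Finsupp.smul_single, Finsupp.smul_single, smul_eq_mul, smul_eq_mul]

theorem toPairModule_resolutionDifferential (i : ℕ)
    (f : BasisSymbol π (i + 1) →₀ MvPolynomial (V ⊕ Fin r) k) :
    toPairModule k π i (resolutionDifferential k π i f) =
      pairDifferential k π (toPairModule k π (i + 1) f) := by
  induction f using Finsupp.induction_linear with
  | zero => simp
  | add f g hf hg => simp only [map_add, hf, hg]
  | single b q =>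
    rw [resolutionDifferential_single, toPairModule_single, pairDifferential_single, map_sum]
    refine Eq.trans ?_ (Finset.sum_attach _ _)
    refine Finset.sum_congr rfl fun x _ => ?_
    simp only [map_sub, toPairModule_single, pairFace, smul_sub, Finsupp.smul_single,
      smul_eq_mul]
    rfl

theorem resolutionDifferential_comp (i : ℕ)
    (f : BasisSymbol π (i + 2) →₀ MvPolynomial (V ⊕ Fin r) k) :
    resolutionDifferential k π i (resolutionDifferential k π (i + 1) f) = 0 := by
  apply toPairModule_injective k π i
  rw [toPairModule_resolutionDifferential, toPairModule_resolutionDifferential,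
    pairDifferential_comp_self, map_zero]

omit [LinearOrder V] in
theorem coe_resolutionAugmentation (f : BasisSymbol π 0 →₀ MvPolynomial (V ⊕ Fin r) k) :
    (resolutionAugmentation k π f : MvPolynomial (V ⊕ Fin r) k) =
      f.sum fun b q => q * coverMonomial k b.cover := by
  rw [resolutionAugmentation, Finsupp.linearCombination_apply, Finsupp.sum, Finsupp.sum,
    AddSubmonoidClass.coe_finsetSum]
  rfl

omit [LinearOrder V] in
theorem resolutionAugmentation_single (b : BasisSymbol π 0) (q : MvPolynomial (V ⊕ Fin r) k) :
    (resolutionAugmentation k π (Finsupp.single b q) : MvPolynomial (V ⊕ Fin r) k) =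
      q * coverMonomial k b.cover := by
  rw [coe_resolutionAugmentation, Finsupp.sum_single_index (zero_mul _)]

theorem resolutionAugmentation_resolutionDifferential
    (f : BasisSymbol π 1 →₀ MvPolynomial (V ⊕ Fin r) k) :
    resolutionAugmentation k π (resolutionDifferential k π 0 f) = 0 := by
  induction f using Finsupp.induction_linear with
  | zero => simp
  | add f g hf hg => simp only [map_add, hf, hg, add_zero]
  | single b q =>
    rw [resolutionDifferential_single, map_sum]
    refine Finset.sum_eq_zero fun x _ => ?_
    rw [map_smul, map_sub]
    convert smul_zero _
    rw [sub_eq_zero, Subtype.ext_iff, resolutionAugmentation_single,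
      resolutionAugmentation_single, mul_assoc, mul_assoc, b.X_mul_coverMonomial_swap k]

theorem resolutionDifferential_homogeneous (i : ℕ) (a : (V ⊕ Fin r) →₀ ℕ)
    (f : BasisSymbol π (i + 1) →₀ MvPolynomial (V ⊕ Fin r) k)
    (hf : IsMultihomogeneous BasisSymbol.multidegree a f) :
    IsMultihomogeneous BasisSymbol.multidegree a (resolutionDifferential k π i f) := by
  rw [← Finsupp.sum_single f, Finsupp.sum, map_sum]
  refine IsMultihomogeneous.sum fun b _ => ?_
  rw [resolutionDifferential_single]
  refine IsMultihomogeneous.sum fun x _ => ?_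
  have h1 : IsMultihomogeneous BasisSymbol.multidegree a
      (Finsupp.single (b.swap x.1 x.2) (f b * X (Sum.inr (π.part x.1)))) :=
    isMultihomogeneous_single_mul_X fun m hm => by
      rw [b.single_add_multidegree_swap]
      exact hf b m hm
  have h2 : IsMultihomogeneous BasisSymbol.multidegree a
      (Finsupp.single (b.drop x.1 x.2) (f b * X (Sum.inl x.1))) :=
    isMultihomogeneous_single_mul_X fun m hm => by
      rw [b.single_add_multidegree_drop]
      exact hf b m hm
  have h3 := h1.add h2.neg
  rw [← sub_eq_add_neg] at h3
  rcases neg_one_pow_eq_or (MvPolynomial (V ⊕ Fin r) k) (signExponent b.face x.1) with h | h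
  · rwa [h, one_smul]
  · rw [h, neg_one_smul]
    exact h3.neg

theorem resolutionAugmentation_homogeneous (a : (V ⊕ Fin r) →₀ ℕ)
    (f : BasisSymbol π 0 →₀ MvPolynomial (V ⊕ Fin r) k)
    (hf : IsMultihomogeneous BasisSymbol.multidegree a f) (m : (V ⊕ Fin r) →₀ ℕ)
    (hm : m ∈ (resolutionAugmentation k π f : MvPolynomial (V ⊕ Fin r) k).support) : m = a := by
  classical
  rw [coe_resolutionAugmentation] at hm
  obtain ⟨b, _, hb⟩ := Finset.mem_biUnion.1 (support_sum hm)
  simp only [coverMonomial_eq_monomial, mem_support_iff, coeff_mul_monomial'] at hb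
  split_ifs at hb with hle
  · rw [mul_one] at hb
    have h := hf b _ (mem_support_iff.2 hb)
    rw [BasisSymbol.multidegree, b.face_eq_empty, Finset.sum_empty, add_zero,
      tsub_add_cancel_of_le hle] at h
    exact h
  · exact absurd rfl hb

theorem resolutionDifferential_minimal (i : ℕ) :
    LinearMap.range (resolutionDifferential k π i) ≤
      (Ideal.span (Set.range X) : Ideal (MvPolynomial (V ⊕ Fin r) k)) •
        (⊤ : Submodule (MvPolynomial (V ⊕ Fin r) k)
          (BasisSymbol π i →₀ MvPolynomial (V ⊕ Fin r) k)) := by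
  have hX : ∀ (b : BasisSymbol π i) (u : V ⊕ Fin r),
      Finsupp.single b (X u) ∈ (Ideal.span (Set.range X) : Ideal (MvPolynomial (V ⊕ Fin r) k)) •
        (⊤ : Submodule (MvPolynomial (V ⊕ Fin r) k)
          (BasisSymbol π i →₀ MvPolynomial (V ⊕ Fin r) k)) := fun b u => by
    rw [← mul_one (X u : MvPolynomial (V ⊕ Fin r) k), ← smul_eq_mul, ← Finsupp.smul_single]
    exact Submodule.smul_mem_smul (Ideal.subset_span ⟨u, rfl⟩) Submodule.mem_top
  rw [resolutionDifferential, Finsupp.range_linearCombination, Submodule.span_le]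
  rintro _ ⟨b, rfl⟩
  exact Submodule.sum_mem _ fun x _ =>
    Submodule.smul_mem _ _ (Submodule.sub_mem _ (hX _ _) (hX _ _))

theorem resolutionAugmentation_surjective :
    Function.Surjective (resolutionAugmentation k π) := by
  have hle : coverIdeal k (cliqueWhiskered π) ≤
      LinearMap.range ((coverIdeal k (cliqueWhiskered π)).subtype ∘ₗ resolutionAugmentation k π) := by
    refine Submodule.span_le.2 ?_
    rintro _ ⟨C, hC, rfl⟩
    -- A cover `C` contains a minimal cover `D`, and `z_C = z_{C ∖ D} z_D`.
    obtain ⟨D, hDC, hD⟩ := exists_minimal_le_of_wellFoundedLT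
      (fun D : Finset (V ⊕ Fin r) => (cliqueWhiskered π).IsVertexCover (D : Set (V ⊕ Fin r))) C hC
    refine ⟨Finsupp.single ⟨D, ∅, hD, by simp, rfl⟩ (coverMonomial k (C \ D)), ?_⟩
    rw [LinearMap.comp_apply, Submodule.subtype_apply, resolutionAugmentation_single]
    exact Finset.prod_sdiff hDC
  rintro ⟨p, hp⟩
  obtain ⟨f, hf⟩ := hle hp
  exact ⟨f, Subtype.ext hf⟩

/-! ### Exactness -/

variable [Fintype V] {k π}

theorem toPairModule_mem_monomialSupported {i : ℕ}
    (f : BasisSymbol π i →₀ MvPolynomial (V ⊕ Fin r) k) :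
    toPairModule k π i f ∈ monomialSupported k {z : _ × ((V ⊕ Fin r) →₀ ℕ) |
      IsSymbolPair π i z.1 ∧ pairLevel z.1 < Fintype.card V + 1} := by
  intro p m h
  have hp : p ∈ Set.range (BasisSymbol.toPair : BasisSymbol π i → _) := by
    by_contra hp
    rw [toPairModule, Finsupp.lmapDomain_apply, Finsupp.mapDomain_of_notMem_range _ _ hp] at h
    simp at h
  obtain ⟨b, rfl⟩ := hp
  exact ⟨⟨b.isMin, b.notMem, b.card_face⟩, Nat.lt_succ_of_le (Finset.card_le_univ _)⟩

omit [LinearOrder V] [Fintype V] in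
theorem exists_toPairModule_eq {i : ℕ} {g : PairModule k V r}
    (hg : g ∈ monomialSupported k {z : _ × ((V ⊕ Fin r) →₀ ℕ) | IsSymbolPair π i z.1}) :
    ∃ f, toPairModule k π i f = g := by
  change g ∈ LinearMap.range (toPairModule k π i)
  refine map_mem_of_mem_monomialSupported LinearMap.id
    (Q := (LinearMap.range (toPairModule k π i)).restrictScalars k) (fun p m hp => ?_) hg
  exact ⟨Finsupp.single ⟨p.1, p.2, hp.1, hp.2.1, hp.2.2⟩ (monomial m 1), toPairModule_single ..⟩

/-- Levels are at most `|V|`, which starts the induction; the primitive it yields is supported on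
genuine symbols, so it lifts to the resolution. -/
theorem exists_sub_resolutionDifferential_mem {i : ℕ}
    {f : BasisSymbol π i →₀ MvPolynomial (V ⊕ Fin r) k}
    (hf : pairDifferential k π (toPairModule k π i f) = 0) :
    ∃ g, ∀ b m, coeff m ((f - resolutionDifferential k π i g) b) ≠ 0 →
      activeSet b.toPair m = ∅ := by
  obtain ⟨g, hg, hfg⟩ :=
    exists_eq_pairDifferential_add _ (toPairModule_mem_monomialSupported f) hf
  obtain ⟨g, rfl⟩ := exists_toPairModule_eq hg
  refine ⟨g, fun b m h => (hfg b.toPair m ?_).2⟩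
  rwa [← toPairModule_resolutionDifferential, ← map_sub, toPairModule_apply]

variable (k π)

theorem resolutionDifferential_exact (i : ℕ) :
    Function.Exact (resolutionDifferential k π (i + 1)) (resolutionDifferential k π i) := by
  intro f
  refine ⟨fun hf => ?_, ?_⟩
  · obtain ⟨g, hg⟩ := exists_sub_resolutionDifferential_mem (f := f)
      (by rw [← toPairModule_resolutionDifferential, hf, map_zero])
    refine ⟨g, (sub_eq_zero.1 ?_).symm⟩
    ext b m
    by_contra h
    -- In positive degree any vertex of the face is active, so no residual term exists.
    obtain ⟨v, hv⟩ : b.face.Nonempty := by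
      rw [← Finset.card_pos, b.card_face]; exact Nat.succ_pos i
    have : v ∈ activeSet b.toPair m := mem_activeSet.2 ⟨b.notMem v hv, Or.inl hv⟩
    simp [hg b m h] at this
  · rintro ⟨g, rfl⟩
    exact resolutionDifferential_comp k π i g

variable {k π}

/-- Distinct residual terms map to distinct monomials: a vertex of `G` divides `m z_C` exactly when
it lies in `C`, so `m z_C` determines `C`, and then `m`. -/
theorem eq_zero_of_resolutionAugmentation_eq_zero
    {f : BasisSymbol π 0 →₀ MvPolynomial (V ⊕ Fin r) k}
    (hact : ∀ b m, coeff m (f b) ≠ 0 → activeSet b.toPair m = ∅)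
    (hf : resolutionAugmentation k π f = 0) : f = 0 := by
  have hzero : ∀ b m, coeff m (f b) ≠ 0 → ∀ v,
      (m + ∑ u ∈ b.cover, Finsupp.single u 1 : (V ⊕ Fin r) →₀ ℕ) (Sum.inl v) = 0 ↔
        Sum.inl v ∉ b.cover := by
    intro b m hm v
    have hnot : v ∉ activeSet b.toPair m := by rw [hact b m hm]; simp
    rw [mem_activeSet] at hnot
    have hsum : (∑ u ∈ b.cover, Finsupp.single u 1 : (V ⊕ Fin r) →₀ ℕ) (Sum.inl v) =
        if Sum.inl v ∈ b.cover then 1 else 0 := by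
      rw [Finsupp.finsetSum_apply]
      simp [Finsupp.single_apply]
    rw [Finsupp.add_apply, hsum]
    by_cases hv : Sum.inl v ∈ b.cover
    · simp [hv]
    · have : m (Sum.inl v) = 0 := by
        by_contra h
        exact hnot ⟨hv, Or.inr h⟩
      simp [hv, this]
  ext b m
  by_contra hm
  replace hm : coeff m (f b) ≠ 0 := hm
  have h := congrArg (fun z : coverIdeal k (cliqueWhiskered π) =>
    coeff (m + ∑ u ∈ b.cover, Finsupp.single u 1) (z : MvPolynomial (V ⊕ Fin r) k)) hf
  simp only [coe_resolutionAugmentation, Finsupp.sum, ZeroMemClass.coe_zero, coeff_zero,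
    coeff_sum, coverMonomial_eq_monomial] at h
  rw [Finset.sum_eq_single b] at h
  · rw [coeff_mul_monomial, mul_one] at h
    exact hm h
  · intro c _ hcb
    rw [coeff_mul_monomial']
    split_ifs with hle
    · rw [mul_one]
      by_contra hc
      -- If another symbol produced the same monomial, its cover would contain the same vertices of
      -- `G`, hence be equal.
      have hcz := hzero c _ hc
      rw [tsub_add_cancel_of_le hle] at hcz
      refine hcb (BasisSymbol.ext (c.isMin.eq_of_inl b.isMin fun v => ?_)
        (c.face_eq_empty.trans b.face_eq_empty.symm))
      exact not_iff_not.1 ((hcz v).symm.trans (hzero b m hm v))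
    · rfl
  · intro hb
    rw [Finsupp.notMem_support_iff.1 hb, zero_mul, coeff_zero]

variable (k π)

theorem resolutionAugmentation_exact :
    Function.Exact (resolutionDifferential k π 0) (resolutionAugmentation k π) := by
  intro f
  refine ⟨fun hf => ?_, ?_⟩
  -- In degree zero all faces are empty, so every element is a cycle of the ambient differential;
  -- the augmentation then kills the residue.
  · have hcycle : pairDifferential k π (toPairModule k π 0 f) = 0 := by
      rw [← Finsupp.sum_single f, Finsupp.sum, map_sum, map_sum]
      refine Finset.sum_eq_zero fun b _ => ?_
      rw [toPairModule_single, pairDifferential_single, BasisSymbol.toPair, b.face_eq_empty,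
        Finset.sum_empty]
    obtain ⟨g, hg⟩ := exists_sub_resolutionDifferential_mem hcycle
    refine ⟨g, (sub_eq_zero.1 (eq_zero_of_resolutionAugmentation_eq_zero hg ?_)).symm⟩
    rw [map_sub, hf, resolutionAugmentation_resolutionDifferential, sub_zero]
  · rintro ⟨g, rfl⟩
    exact resolutionAugmentation_resolutionDifferential k π g

end Resolution

theorem mainTheorem1 (k : Type*) [Field k] {V : Type*} [Fintype V] [LinearOrder V]
    (G : SimpleGraph V) (r : ℕ) (π : CliquePartition G r) (hord : Monotone π.part) :
    IsMinimalFreeResolution (coverIdeal k (cliqueWhiskered π)) (BasisSymbol π)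
      (fun _ f => f.multidegree) (resolutionDifferential k π) (resolutionAugmentation k π) where
  finite _ := inferInstance
  homogeneous_d := resolutionDifferential_homogeneous k π
  homogeneous_ε := resolutionAugmentation_homogeneous k π
  exact_d := resolutionDifferential_exact k π
  exact_ε := resolutionAugmentation_exact k π
  surjective_ε := resolutionAugmentation_surjective k π
  minimal := resolutionDifferential_minimal k π
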